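/- Let $n,m,J\ge 0$ and let $k_1,\dots,k_J\ge 1$ be integers with $r:=k_1+\cdots+k_J\le\min(n,m)$. Let $\mathcal S\subset\mathbb R^{n\times m}$ be the set of real $n\times m$ matrices $A$ having a singular value decomposition $A=U\Sigma V^{T}$ with $U\in\mathbb R^{n\times n}$ and $V\in\mathbb R^{m\times m}$ orthogonal and $\Sigma\in\mathbb R^{n\times m}$ diagonal with diagonal entries $$\underbrace{\sigma_1,\dots,\sigma_1}_{k_1},\ \dots,\ \underbrace{\sigma_J,\dots,\sigma_J}_{k_J},\ 0,\dots,0$$ for some real numbers $\sigma_1>\sigma_2>\cdots>\sigma_J>0$; that is, the largest singular value has multiplicity $k_1$, the next largest has multiplicity $k_2$, and so on, and the rank is $r$. Say that a subset of $\mathbb R^{n\times m}$ has real dimension $d$ if it is a nonempty smooth embedded submanifold of $\mathbb R^{n\times m}$ of dimension $d$. Then $\mathcal S$ has real dimension $$\dim\mathcal S=(n+m-r)\,r-r-\frac12\sum_{j=1}^{J}k_j(k_j-1)+J .$$ Moreover, $\mathcal S$ is contained in the set of real $n\times m$ matrices of rank $r$, that set also has a real dimension, and the codimension of $\mathcal S$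 in it (the difference of the two dimensions) is $$\frac12\sum_{j=1}^{J}k_j(k_j-1)+r-J .$$ -/

import Mathlib

open scoped ContDiff

/- The entrywise sup norm on real matrices. It is only used to speak of smooth maps and open sets,
and for these all norms on this finite-dimensional space are equivalent. -/
attribute [local instance] Matrix.normedAddCommGroup Matrix.normedSpace

/-- `S` is a smooth embedded submanifold, of dimension `d` at each of its points, of the
finite-dimensional real space `E`: around every point of `S` there is a smooth change of
coordinates `φ` of `E` (a smooth diffeomorphism between open sets) that carries `S` to a
`d`-dimensional linear subspace `W`. -/
def IsSmoothSubmanifold {E : Type*} [NormedAddCommGroup E] [NormedSpace ℝ E]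
    (S : Set E) (d : ℕ) : Prop :=
  ∀ x ∈ S, ∃ (φ : OpenPartialHomeomorph E E) (W : Submodule ℝ E),
    x ∈ φ.source ∧
    ContDiffOn ℝ ∞ φ φ.source ∧
    ContDiffOn ℝ ∞ φ.symm φ.target ∧
    Module.finrank ℝ W = d ∧
    ∀ y ∈ φ.source, y ∈ S ↔ φ y ∈ W

/-- `S` is a set of real dimension `d`: a nonempty smooth embedded submanifold of dimension `d`. -/
def HasRealDim {E : Type*} [NormedAddCommGroup E] [NormedSpace ℝ E]
    (S : Set E) (d : ℕ) : Prop :=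
  S.Nonempty ∧ IsSmoothSubmanifold S d

/-- `S` has real codimension `c` within `T`: it is a subset of `T`, both sets have a dimension,
and the dimension of `T` exceeds that of `S` by `c`. -/
def HasRealCodimIn {E : Type*} [NormedAddCommGroup E] [NormedSpace ℝ E]
    (S T : Set E) (c : ℕ) : Prop :=
  S ⊆ T ∧ ∃ d e : ℕ, HasRealDim S d ∧ HasRealDim T e ∧ e = d + c

/-- The `n × m` diagonal matrix `Σ` whose first `k 0` diagonal entries are `σ 0`, the next `k 1`
are `σ 1`, and so on, and all of whose other entries vanish. The equivalence `finSigmaFinEquiv`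
enumerates the blocks consecutively; its inverse gives the block that contains a position. -/
def singularValueMatrix (n m : ℕ) {J : ℕ} (k : Fin J → ℕ) (σ : Fin J → ℝ) :
    Matrix (Fin n) (Fin m) ℝ :=
  Matrix.of fun i i' =>
    if h : (i : ℕ) = (i' : ℕ) ∧ (i : ℕ) < ∑ j, k j then
      σ (finSigmaFinEquiv.symm (⟨(i : ℕ), h.2⟩ : Fin (∑ j, k j))).1
    else 0

/-- The real `n × m` matrices whose distinct nonzero singular values `σ 0 > σ 1 > ⋯ > 0` have
multiplicities `k 0, k 1, …`: those with a singular value decomposition `A = U Σ Vᵀ` in which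
`U` and `V` are orthogonal and `Σ` carries each `σ j` exactly `k j` times. -/
def matricesWithMult (n m : ℕ) {J : ℕ} (k : Fin J → ℕ) : Set (Matrix (Fin n) (Fin m) ℝ) :=
  {A | ∃ σ : Fin J → ℝ, StrictAnti σ ∧ (∀ j, 0 < σ j) ∧
    ∃ U ∈ Matrix.orthogonalGroup (Fin n) ℝ, ∃ V ∈ Matrix.orthogonalGroup (Fin m) ℝ,
      A = U * singularValueMatrix n m k σ * V.transpose}

/-! Both sets are invariant under `A ↦ U * A * Vᵀ` with `U`, `V` orthogonal. The tangent space at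
`S` to its orbit is `{X * S + S * Yᵀ : X, Y skew}`; its complement for the trace form is `N = {B : B
* Sᵀ and Bᵀ * S symmetric}`, which contains `S`. Moving points of `N` by exponentials of skew
matrices gives a local diffeomorphism at `S`. Hence, if an invariant set agrees with a linear
subspace `W ≤ N` inside `N` near `S`, it is a submanifold there, of dimension `nm - dim N + dim W`
(`hasSmoothSliceAt_of_orthogonal_invariant`).

At the diagonal matrix `Σ`, `N` consists of a symmetric block of size `k j` for each `j` and an
arbitrary `(n - r) × (m - r)` corner (`range_symmBlocks`). For the matrices of rank `r`, `W` is
given by a vanishing corner. For prescribed multiplicities, `W` is the `J`-dimensional space of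
scalar blocks (`eventually_mem_range_blockSigma`): the rank kills the corner, the eigenvalues of
block `j` stay near `σ j` and are singular values, and only `J` distinct nonzero ones exist, so each
block has a single eigenvalue and is scalar.

Linear automorphisms preserving the set in question carry any of its points to such a `Σ`, so the
local statement suffices. -/

/-! ### Slice charts and their transport -/

section Slices

variable {E F : Type*} [NormedAddCommGroup E] [NormedSpace ℝ E]
  [NormedAddCommGroup F] [NormedSpace ℝ F]

/-- Around the point `x`, a smooth change of coordinates carries `S` to a `d`-dimensional linear
subspace. -/
def HasSmoothSliceAt (S : Set E) (d : ℕ) (x : E) : Prop :=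
  ∃ (φ : OpenPartialHomeomorph E E) (W : Submodule ℝ E),
    x ∈ φ.source ∧
    ContDiffOn ℝ ∞ φ φ.source ∧
    ContDiffOn ℝ ∞ φ.symm φ.target ∧
    Module.finrank ℝ W = d ∧
    ∀ y ∈ φ.source, y ∈ S ↔ φ y ∈ W

/-- A local parametrization that is the identity to first order at `x` and straightens `S`. -/
theorem HasSmoothSliceAt.of_contDiff [CompleteSpace E] {S : Set E} {f : E → E} {x : E}
    {W : Submodule ℝ E} (hf : ContDiff ℝ ∞ f)
    (hf' : HasFDerivAt f (ContinuousLinearMap.id ℝ E) x) (hfx : f x = x)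
    (hS : ∀ᶠ z in nhds x, f z ∈ S ↔ z ∈ W) :
    HasSmoothSliceAt S (Module.finrank ℝ W) x := by
  have hne : (∞ : WithTop ℕ∞) ≠ 0 := by simp
  have hf'' : HasFDerivAt f ((ContinuousLinearEquiv.refl ℝ E : E ≃L[ℝ] E) : E →L[ℝ] E) x := hf'
  set ψ := hf.contDiffAt.toOpenPartialHomeomorph f hf'' hne with hψ
  have hcoe : (ψ : E → E) = f := rfl
  -- The inverse function theorem controls the derivative only at `x`. Restricting to the open set
  -- where it is invertible makes the local inverse smooth on its whole domain.
  have hinv : IsOpen {z | fderiv ℝ f z ∈ Set.range ((↑) : (E ≃L[ℝ] E) → E →L[ℝ] E)} :=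
    ContinuousLinearEquiv.isOpen.preimage (hf.continuous_fderiv hne)
  obtain ⟨t, ht, hto, hxt⟩ := eventually_nhds_iff.mp hS
  have hso := hinv.inter hto
  set χ := ψ.restrOpen _ hso with hχ
  have hχs : χ.source = ψ.source ∩ _ := ψ.restrOpen_source _ hso
  have hxs : x ∈ χ.source := by
    rw [hχs]
    refine ⟨hf.contDiffAt.mem_toOpenPartialHomeomorph_source hf'' hne, ?_, hxt⟩
    exact ⟨ContinuousLinearEquiv.refl ℝ E, hf''.fderiv.symm⟩
  have hχc : (χ : E → E) = f := rfl
  refine ⟨χ.symm, W, ?_, ?_, ?_, rfl, ?_⟩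
  · have := χ.map_source hxs
    rwa [hχc, hfx] at this
  · intro y hy
    have hy' : χ.symm y ∈ χ.source := χ.map_target hy
    rw [hχs] at hy'
    obtain ⟨e, he⟩ := hy'.2.1
    refine (χ.contDiffAt_symm (f₀' := e) hy ?_ hf.contDiffAt).contDiffWithinAt
    rw [he, hχc]
    exact (hf.differentiable hne _).hasFDerivAt
  · exact hf.contDiffOn
  · intro y hy
    have hy' : χ.symm y ∈ χ.source := χ.map_target hy
    rw [hχs] at hy'
    have h1 := ht _ hy'.2.2
    rwa [show f (χ.symm y) = y from χ.right_inv hy] at h1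

/-- Conjugating the chart by `e` works. This moves a slice from a normal form to an arbitrary point,
and between index types. -/
theorem HasSmoothSliceAt.comap {S : Set E} {T : Set F} {d : ℕ} {x : E} (e : E ≃L[ℝ] F)
    (h : HasSmoothSliceAt T d (e x)) (hST : ∀ y, y ∈ S ↔ e y ∈ T) : HasSmoothSliceAt S d x := by
  obtain ⟨φ, W, hx, h1, h2, hd, hW⟩ := h
  refine ⟨e.toHomeomorph.toOpenPartialHomeomorph.trans
    (φ.trans e.symm.toHomeomorph.toOpenPartialHomeomorph),
    W.comap (e : E →ₗ[ℝ] F), ?_, ?_, ?_, ?_, ?_⟩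
  · simpa using hx
  · refine (e.symm.contDiff.comp_contDiffOn
      (h1.comp e.contDiff.contDiffOn (s := e ⁻¹' φ.source) fun y hy ↦ hy)).congr_mono
        (fun y _ ↦ rfl) fun y hy ↦ ?_
    simpa using hy
  · refine (e.symm.contDiff.comp_contDiffOn
      (h2.comp e.contDiff.contDiffOn (s := e ⁻¹' φ.target) fun y hy ↦ hy)).congr_mono
        (fun y _ ↦ rfl) fun y hy ↦ ?_
    simpa using hy
  · rw [← hd]
    rw [← LinearEquiv.finrank_map_eq e.toLinearEquiv (W.comap (e : E →ₗ[ℝ] F))]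
    exact congrArg (fun P : Submodule ℝ F ↦ Module.finrank ℝ P)
      (Submodule.map_comap_eq_of_surjective e.surjective W)
  · intro y hy
    simpa [hST] using hW (e y) (by simpa using hy)

end Slices

/-! ### Equivalence of linear maps of equal rank -/

section Equivalence

variable {K V W : Type*} [Field K] [AddCommGroup V] [Module K V] [AddCommGroup W] [Module K W]
  [FiniteDimensional K V] [FiniteDimensional K W]

open Module in
/-- Linear maps of the same rank are equivalent. -/
theorem LinearMap.exists_equiv_comp_eq_of_finrank_range_eq (f g : V →ₗ[K] W)
    (h : finrank K (LinearMap.range f) = finrank K (LinearMap.range g)) :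
    ∃ (a : V ≃ₗ[K] V) (b : W ≃ₗ[K] W), ∀ v, b (f v) = g (a v) := by
  obtain ⟨C, hC⟩ := (LinearMap.ker f).exists_isCompl
  obtain ⟨C', hC'⟩ := (LinearMap.ker g).exists_isCompl
  obtain ⟨D, hD⟩ := (LinearMap.range f).exists_isCompl
  obtain ⟨D', hD'⟩ := (LinearMap.range g).exists_isCompl
  have e1 : LinearMap.range f ≃ₗ[K] LinearMap.range g := LinearEquiv.ofFinrankEq _ _ h
  have e2 : LinearMap.ker f ≃ₗ[K] LinearMap.ker g := LinearEquiv.ofFinrankEq _ _ (by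
    have := f.finrank_range_add_finrank_ker
    have := g.finrank_range_add_finrank_ker
    omega)
  have e3 : D ≃ₗ[K] D' := LinearEquiv.ofFinrankEq _ _ (by
    have := Submodule.finrank_add_eq_of_isCompl hD
    have := Submodule.finrank_add_eq_of_isCompl hD'
    omega)
  let p := LinearMap.equivProdOfSurjectiveOfIsCompl f.rangeRestrict
    ((LinearMap.ker f).projectionOnto C hC) f.range_rangeRestrict
    (Submodule.range_projectionOnto hC) (by
      rw [LinearMap.ker_rangeRestrict, Submodule.ker_projectionOnto]; exact hC)
  let q := LinearMap.equivProdOfSurjectiveOfIsCompl g.rangeRestrict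
    ((LinearMap.ker g).projectionOnto C' hC') g.range_rangeRestrict
    (Submodule.range_projectionOnto hC') (by
      rw [LinearMap.ker_rangeRestrict, Submodule.ker_projectionOnto]; exact hC')
  refine ⟨p.trans ((e1.prodCongr e2).trans q.symm),
    (Submodule.prodEquivOfIsCompl _ _ hD).symm.trans
      ((e1.prodCongr e3).trans (Submodule.prodEquivOfIsCompl _ _ hD')), fun v ↦ ?_⟩
  have key : g.rangeRestrict (q.symm (e1 (f.rangeRestrict v), e2 ((p v).2))) =
      e1 (f.rangeRestrict v) := by
    have := congrArg Prod.fst (q.apply_symm_apply (e1 (f.rangeRestrict v), e2 ((p v).2)))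
    exact this
  have hs : (Submodule.prodEquivOfIsCompl _ _ hD).symm (f v) = (f.rangeRestrict v, 0) :=
    Submodule.prodEquivOfIsCompl_symm_apply_left _ _ hD (f.rangeRestrict v)
  simp only [LinearEquiv.trans_apply, hs, LinearEquiv.prodCongr_apply, map_zero]
  refine Eq.trans ?_ (congrArg Subtype.val key).symm
  rw [Submodule.coe_prodEquivOfIsCompl']
  simp

end Equivalence

/-! ### The exponential chart of the orthogonal group -/

open NormedSpace in
/-- A smooth map that carries skew-symmetric matrices to orthogonal ones and is tangent to `1 + X`
at the origin. -/
theorem Matrix.exists_smooth_orthogonal_chart (ι : Type*) [Fintype ι] [DecidableEq ι] :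
    ∃ u : Matrix ι ι ℝ → Matrix ι ι ℝ, ContDiff ℝ ∞ u ∧ u 0 = 1 ∧
      HasFDerivAt u (ContinuousLinearMap.id ℝ (Matrix ι ι ℝ)) 0 ∧
      ∀ X, X.transpose = -X → u X ∈ Matrix.orthogonalGroup ι ℝ := by
  -- The sup norm is not submultiplicative, so the exponential is taken among operators on Euclidean
  -- space, where the transpose becomes the adjoint.
  let e : Matrix ι ι ℝ ≃⋆ₐ[ℝ] (EuclideanSpace ℝ ι →L[ℝ] EuclideanSpace ℝ ι) :=
    Matrix.toEuclideanCLM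
  let e' : Matrix ι ι ℝ ≃L[ℝ] (EuclideanSpace ℝ ι →L[ℝ] EuclideanSpace ℝ ι) :=
    e.toAlgEquiv.toLinearEquiv.toContinuousLinearEquiv
  refine ⟨fun X ↦ e'.symm (exp (e' X)), ?_, ?_, ?_, ?_⟩
  · refine e'.symm.contDiff.comp (ContDiff.comp ?_ e'.contDiff)
    exact contDiff_iff_contDiffAt.mpr fun x ↦ (exp_analytic (𝕂 := ℝ) x).contDiffAt
  · simp [exp_zero]
    exact map_one e.symm
  · have h1 : HasFDerivAt (exp : (EuclideanSpace ℝ ι →L[ℝ] EuclideanSpace ℝ ι) → _)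
        (ContinuousLinearMap.id ℝ _) (e' 0) := by
      rw [map_zero]; exact hasFDerivAt_exp_zero (𝕂 := ℝ)
    have := e'.symm.hasFDerivAt.comp (0 : Matrix ι ι ℝ) (h1.comp 0 e'.hasFDerivAt)
    convert! this using 1
    ext1 X
    exact (e'.symm_apply_apply X).symm
  · intro X hX
    have hskew : e X ∈ skewAdjoint _ := by
      rw [skewAdjoint.mem_iff, ← map_star, ← map_neg]
      congr 1
    let _ := NormedAlgebra.restrictScalars ℚ ℝ
      (EuclideanSpace ℝ ι →L[ℝ] EuclideanSpace ℝ ι)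
    have h2 := exp_mem_unitary_of_mem_skewAdjoint hskew
    have h3 : e.symm (exp (e X)) ∈ unitary (Matrix ι ι ℝ) := Unitary.map_mem e.symm h2
    exact h3


/-! ### Orbits of the orthogonal groups and their normal slices -/

namespace Matrix

variable {ι κ ρ : Type*} [Fintype ι] [Fintype κ] [Fintype ρ]

open LinearMap in
/-- Some linear automorphism of the space of matrices preserves the rank and carries `A` to a given
matrix `B` of the same rank. -/
theorem exists_linearEquiv_of_rank_eq [DecidableEq κ] {K : Type*} [Field K] {A B : Matrix ι κ K}
    (h : A.rank = B.rank) :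
    ∃ e : Matrix ι κ K ≃ₗ[K] Matrix ι κ K, e A = B ∧ ∀ X, (e X).rank = X.rank := by
  obtain ⟨a, b, hab⟩ := LinearMap.exists_equiv_comp_eq_of_finrank_range_eq A.mulVecLin B.mulVecLin h
  refine ⟨toLin'.trans ((a.arrowCongr b).trans toMatrix'), ?_, fun X ↦ ?_⟩
  · have : a.arrowCongr b (toLin' A) = toLin' B := by
      ext1 v
      refine LinearMap.ext fun c ↦ ?_
      have := hab (a.symm (Pi.single v c))
      simpa [LinearEquiv.arrowCongr_apply] using this
    simp [this]
  · rw [rank, ← toLin'_apply', rank, ← toLin'_apply']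
    have : toLin' (toLin'.trans ((a.arrowCongr b).trans toMatrix') X) =
        (b : (ι → K) →ₗ[K] (ι → K)) ∘ₗ toLin' X ∘ₗ (a.symm : (κ → K) →ₗ[K] (κ → K)) := by
      refine LinearMap.ext fun v ↦ ?_; simp [LinearEquiv.arrowCongr_apply]
    rw [this, range_comp, range_comp_of_range_eq_top _ a.symm.range]
    exact b.finrank_map_eq _

variable (ι κ ρ) in
/-- Matrix multiplication as a continuous bilinear map. -/
noncomputable def mulContinuousBilin :
    Matrix ι κ ℝ →L[ℝ] Matrix κ ρ ℝ →L[ℝ] Matrix ι ρ ℝ :=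
  (LinearMap.mk₂ ℝ (fun (A : Matrix ι κ ℝ) (B : Matrix κ ρ ℝ) ↦ A * B) Matrix.add_mul
    Matrix.smul_mul Matrix.mul_add fun c A B ↦ Matrix.mul_smul A c B).toContinuousBilinearMap

variable (ι) in
/-- The skew-symmetric matrices. -/
def skewSubmodule : Submodule ℝ (Matrix ι ι ℝ) where
  carrier := {X | Xᵀ = -X}
  add_mem' {X Y} hX hY := by
    simp only [Set.mem_ofPred_eq] at *
    rw [transpose_add, hX, hY, neg_add]
  zero_mem' := by simp
  smul_mem' c X hX := by
    simp only [Set.mem_ofPred_eq] at *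
    rw [transpose_smul, hX, smul_neg]

omit [Fintype ι] in
theorem mem_skewSubmodule {X : Matrix ι ι ℝ} : X ∈ skewSubmodule ι ↔ Xᵀ = -X := Iff.rfl

/-- The differential at the identity of `(U, V) ↦ U S Vᵀ`. -/
def orbitTangent (S : Matrix ι κ ℝ) :
    (skewSubmodule ι × skewSubmodule κ) →ₗ[ℝ] Matrix ι κ ℝ where
  toFun p := (p.1 : Matrix ι ι ℝ) * S + S * (p.2 : Matrix κ κ ℝ)ᵀ
  map_add' p q := by
    simp only [Prod.fst_add, Prod.snd_add, Submodule.coe_add, transpose_add, Matrix.add_mul,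
      Matrix.mul_add]
    abel
  map_smul' c p := by simp

theorem orbitTangent_apply (S : Matrix ι κ ℝ) (p : skewSubmodule ι × skewSubmodule κ) :
    orbitTangent S p = (p.1 : Matrix ι ι ℝ) * S + S * (p.2 : Matrix κ κ ℝ)ᵀ := rfl

/-- The orthogonal complement, for the trace form, of the tangent space at `S` to the orbit of `S`
under the two orthogonal groups. -/
def orbitNormal (S : Matrix ι κ ℝ) : Submodule ℝ (Matrix ι κ ℝ) where
  carrier := {B | (B * Sᵀ).IsSymm ∧ (Bᵀ * S).IsSymm}
  add_mem' {X Y} hX hY := by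
    simp only [Set.mem_ofPred_eq, Matrix.add_mul, transpose_add] at *
    exact ⟨hX.1.add hY.1, hX.2.add hY.2⟩
  zero_mem' := by simp [IsSymm]
  smul_mem' c X hX := by
    simp only [Set.mem_ofPred_eq, Matrix.smul_mul, transpose_smul] at *
    exact ⟨hX.1.smul c, hX.2.smul c⟩

theorem mem_orbitNormal {S B : Matrix ι κ ℝ} :
    B ∈ orbitNormal S ↔ (B * Sᵀ).IsSymm ∧ (Bᵀ * S).IsSymm := Iff.rfl

variable (ι κ) in
/-- The trace form `(A, B) ↦ tr (Aᵀ B)`. -/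
def transposeTraceForm : LinearMap.BilinForm ℝ (Matrix ι κ ℝ) :=
  LinearMap.mk₂ ℝ (fun A B ↦ (Aᵀ * B).trace)
    (fun A B C ↦ by rw [transpose_add, Matrix.add_mul, trace_add])
    (fun c A B ↦ by rw [transpose_smul, Matrix.smul_mul, trace_smul])
    (fun A B C ↦ by rw [Matrix.mul_add, trace_add])
    (fun c A B ↦ by rw [Matrix.mul_smul, trace_smul])

theorem transposeTraceForm_apply (A B : Matrix ι κ ℝ) :
    transposeTraceForm ι κ A B = (Aᵀ * B).trace := rfl

theorem transposeTraceForm_isRefl : (transposeTraceForm ι κ).IsRefl := fun A B h ↦ by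
  rw [transposeTraceForm_apply] at *
  rw [← h, ← trace_transpose, transpose_mul, transpose_transpose]

theorem trace_transpose_mul_self_eq_zero {A : Matrix ι κ ℝ} (h : (Aᵀ * A).trace = 0) : A = 0 := by
  rw [← conjTranspose_eq_transpose_of_trivial] at h
  exact trace_conjTranspose_mul_self_eq_zero_iff.mp h

/-- A matrix is symmetric if it is orthogonal to all skew-symmetric matrices. -/
theorem isSymm_of_trace_skew {Z : Matrix ι ι ℝ}
    (h : ∀ X ∈ skewSubmodule ι, (X * Z).trace = 0) : Z.IsSymm := by
  have h1 := h (Z - Zᵀ) (by simp [mem_skewSubmodule])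
  have h2 : ((Z - Zᵀ)ᵀ * (Z - Zᵀ)).trace = 0 := by
    have h3 : ((Z - Zᵀ) * Zᵀ).trace = -((Z - Zᵀ) * Z).trace := by
      rw [← trace_transpose, transpose_mul, transpose_transpose, transpose_sub,
        transpose_transpose, trace_mul_comm, ← trace_neg, ← Matrix.neg_mul, neg_sub]
    rw [transpose_sub, transpose_transpose, ← neg_sub Z, Matrix.neg_mul, Matrix.mul_sub,
      trace_neg, trace_sub, h3, h1]
    simp
  exact (sub_eq_zero.mp (trace_transpose_mul_self_eq_zero h2)).symm

theorem trace_skew_mul_eq_zero {X Z : Matrix ι ι ℝ} (hX : X ∈ skewSubmodule ι)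
    (hZ : Z.IsSymm) : (X * Z).trace = 0 := by
  have h : (X * Z).trace = -(X * Z).trace := by
    conv_lhs => rw [← trace_transpose, transpose_mul, mem_skewSubmodule.mp hX, hZ.eq,
      trace_mul_comm, Matrix.neg_mul, trace_neg]
  linarith

theorem transposeTraceForm_orbitTangent (S B : Matrix ι κ ℝ)
    (p : skewSubmodule ι × skewSubmodule κ) :
    transposeTraceForm ι κ (orbitTangent S p) B =
      -((p.1 : Matrix ι ι ℝ) * (B * Sᵀ)).trace + ((p.2 : Matrix κ κ ℝ) * (Sᵀ * B)).trace := by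
  have h1 := mem_skewSubmodule.mp p.1.2
  rw [transposeTraceForm_apply, orbitTangent_apply, transpose_add, transpose_mul, transpose_mul, h1,
    transpose_transpose, Matrix.add_mul, trace_add, Matrix.mul_assoc, Matrix.mul_assoc,
    trace_mul_comm, Matrix.neg_mul, Matrix.neg_mul, trace_neg, Matrix.mul_assoc]

/-- Pairing `B` with a tangent vector gives traces of skew matrices against `B * Sᵀ` and `Sᵀ * B`;
these all vanish exactly when both products are symmetric. -/
theorem orthogonal_range_orbitTangent (S : Matrix ι κ ℝ) :
    (transposeTraceForm ι κ).orthogonal (LinearMap.range (orbitTangent S)) = orbitNormal S := by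
  ext B
  have hT : (Sᵀ * B)ᵀ = Bᵀ * S := by rw [transpose_mul, transpose_transpose]
  have hT' : (Bᵀ * S).IsSymm ↔ (Sᵀ * B).IsSymm := by
    rw [← hT]
    exact ⟨fun h ↦ by simpa using h.transpose, fun h ↦ h.transpose⟩
  rw [LinearMap.BilinForm.mem_orthogonal_iff, mem_orbitNormal, hT']
  constructor
  · intro h
    refine ⟨isSymm_of_trace_skew fun X hX ↦ ?_, isSymm_of_trace_skew fun X hX ↦ ?_⟩
    · have := h _ ⟨(⟨X, hX⟩, 0), rfl⟩
      rw [transposeTraceForm_orbitTangent] at this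
      simpa using this
    · have := h _ ⟨(0, ⟨X, hX⟩), rfl⟩
      rw [transposeTraceForm_orbitTangent] at this
      simpa using this
  · rintro ⟨h1, h2⟩ _ ⟨p, rfl⟩
    rw [transposeTraceForm_orbitTangent,
      trace_skew_mul_eq_zero p.1.2 h1, trace_skew_mul_eq_zero p.2.2 h2]
    simp

/-- The trace form is positive definite, so a subspace meets its orthogonal only in `0`. -/
theorem isCompl_range_orbitTangent (S : Matrix ι κ ℝ) :
    IsCompl (LinearMap.range (orbitTangent S)) (orbitNormal S) := by
  rw [← orthogonal_range_orbitTangent,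
    LinearMap.BilinForm.isCompl_orthogonal_iff_disjoint transposeTraceForm_isRefl,
    Submodule.disjoint_def]
  intro A hA hA'
  exact trace_transpose_mul_self_eq_zero (hA' A hA)

theorem self_mem_orbitNormal (S : Matrix ι κ ℝ) : S ∈ orbitNormal S :=
  ⟨by rw [IsSymm, transpose_mul, transpose_transpose], by
    rw [IsSymm, transpose_mul, transpose_transpose]⟩

open _root_.Module in
/-- If a set of matrices is invariant under the orthogonal groups and coincides near `S` with a
linear subspace of the normal space to the orbit of `S`, then it is a submanifold near `S`. -/
theorem hasSmoothSliceAt_of_orthogonal_invariant [DecidableEq ι] [DecidableEq κ]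
    {T : Set (Matrix ι κ ℝ)} {S : Matrix ι κ ℝ} {W : Submodule ℝ (Matrix ι κ ℝ)}
    (hW : W ≤ orbitNormal S)
    (hT : ∀ U ∈ orthogonalGroup ι ℝ, ∀ V ∈ orthogonalGroup κ ℝ, ∀ A ∈ T, U * A * Vᵀ ∈ T)
    (hloc : ∀ᶠ D in nhds S, D ∈ orbitNormal S → (D ∈ T ↔ D ∈ W)) :
    ∃ d, HasSmoothSliceAt T d S ∧
      d + finrank ℝ (orbitNormal S) = Fintype.card ι * Fintype.card κ + finrank ℝ W := by
  have hc := isCompl_range_orbitTangent S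
  set R := LinearMap.range (orbitTangent S) with hR
  -- A linear section `g` chooses skew matrices producing a given tangent vector, so stabilizers
  -- need not be divided out.
  obtain ⟨g, hg⟩ := (orbitTangent S).rangeRestrict.exists_rightInverse_of_surjective
    (orbitTangent S).range_rangeRestrict
  let q := R.projectionOnto _ hc
  let s₁ : Matrix ι κ ℝ →L[ℝ] Matrix ι ι ℝ := LinearMap.toContinuousLinearMap
    ((skewSubmodule ι).subtype ∘ₗ LinearMap.fst ℝ _ _ ∘ₗ g ∘ₗ q)
  let s₂ : Matrix ι κ ℝ →L[ℝ] Matrix κ κ ℝ := LinearMap.toContinuousLinearMap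
    ((skewSubmodule κ).subtype ∘ₗ LinearMap.snd ℝ _ _ ∘ₗ g ∘ₗ q)
  let π : Matrix ι κ ℝ →L[ℝ] Matrix ι κ ℝ := LinearMap.toContinuousLinearMap
    ((orbitNormal S).projection _ hc.symm)
  let τ : Matrix κ κ ℝ →L[ℝ] Matrix κ κ ℝ := LinearMap.toContinuousLinearMap
    (transposeLinearEquiv κ κ ℝ ℝ : Matrix κ κ ℝ →ₗ[ℝ] Matrix κ κ ℝ)
  have hs₁ (z) : (s₁ z)ᵀ = -s₁ z := (g (q z)).1.2
  have hs₂ (z) : (s₂ z)ᵀ = -s₂ z := (g (q z)).2.2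
  have hsum (z) : s₁ z * S + S * (s₂ z)ᵀ + π z = z := by
    have h1 : orbitTangent S (g (q z)) = q z :=
      congrArg Subtype.val (LinearMap.congr_fun hg (q z))
    have h2 : ((q z : R) : Matrix ι κ ℝ) + π z = z := by
      exact Submodule.projection_add_projection_eq_self hc z
    rw [← h1] at h2
    exact h2
  have hqS : q S = 0 := (Submodule.projectionOnto_apply_eq_zero_iff hc).mpr (self_mem_orbitNormal S)
  have hs₁S : s₁ S = 0 := by simp [s₁, hqS]
  have hs₂S : s₂ S = 0 := by simp [s₂, hqS]
  have hπS : π S = S := Submodule.projection_apply_of_mem_left hc.symm (self_mem_orbitNormal S)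
  obtain ⟨u, hu, hu1, hud, huo⟩ := exists_smooth_orthogonal_chart ι
  obtain ⟨v, hv, hv1, hvd, hvo⟩ := exists_smooth_orthogonal_chart κ
  let f : Matrix ι κ ℝ → Matrix ι κ ℝ := fun z ↦
    mulContinuousBilin ι κ κ (mulContinuousBilin ι ι κ (u (s₁ z)) (π z)) (τ (v (s₂ z)))
  have hfv (z) : f z = u (s₁ z) * π z * (v (s₂ z))ᵀ := rfl
  have hf : ContDiff ℝ ∞ f := by
    refine (mulContinuousBilin ι κ κ).isBoundedBilinearMap.contDiff.comp₂ ?_ ?_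
    · exact (mulContinuousBilin ι ι κ).isBoundedBilinearMap.contDiff.comp₂ (hu.comp s₁.contDiff)
        π.contDiff
    · exact τ.contDiff.comp (hv.comp s₂.contDiff)
  have hfS : f S = S := by simp [hfv, hs₁S, hs₂S, hπS, hu1, hv1]
  have hf' : HasFDerivAt f (ContinuousLinearMap.id ℝ _) S := by
    rw [← hs₁S] at hud
    rw [← hs₂S] at hvd
    have h1 := (mulContinuousBilin ι ι κ).hasFDerivAt_of_bilinear
      (hud.comp S s₁.hasFDerivAt) π.hasFDerivAt
    have h2 := (mulContinuousBilin ι κ κ).hasFDerivAt_of_bilinear h1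
      (τ.hasFDerivAt.comp S (hvd.comp S s₂.hasFDerivAt))
    refine h2.congr_fderiv ?_
    ext1 z
    -- By the product rule the derivative is the tangential part plus the normal part of `z`, which
    -- `hsum` adds up to `z`.
    change u (s₁ S) * π S * (s₂ z)ᵀ + (u (s₁ S) * π z + s₁ z * π S) * (v (s₂ S))ᵀ = z
    rw [hs₁S, hs₂S, hπS, hu1, hv1, transpose_one, Matrix.mul_one, Matrix.one_mul, Matrix.one_mul]
    conv_rhs => rw [← hsum z]
    abel
  have hfT (z) : f z ∈ T ↔ π z ∈ T := by
    have hU := huo _ (hs₁ z)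
    have hV := hvo _ (hs₂ z)
    refine ⟨fun h ↦ ?_, fun h ↦ hT _ hU _ hV _ h⟩
    have h1 := hT _ (Unitary.star_mem hU) _ (Unitary.star_mem hV) _ h
    rw [mem_orthogonalGroup_iff'] at hU hV
    rwa [star_eq_conjTranspose, star_eq_conjTranspose, conjTranspose_eq_transpose_of_trivial,
      conjTranspose_eq_transpose_of_trivial, transpose_transpose, hfv, Matrix.mul_assoc,
      Matrix.mul_assoc, hV, Matrix.mul_one, ← Matrix.mul_assoc, hU, Matrix.one_mul] at h1
  have hmem (z) : z ∈ W ⊔ R ↔ π z ∈ W := by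
    constructor
    · intro h
      obtain ⟨w, hw, t, ht, rfl⟩ := Submodule.mem_sup.mp h
      have h1 : π w = w := Submodule.projection_apply_of_mem_left hc.symm (hW hw)
      have h2 : π t = 0 := (Submodule.projection_apply_eq_zero_iff hc.symm).mpr ht
      rwa [map_add, h1, h2, add_zero]
    · intro h
      rw [← hsum z, add_comm]
      exact Submodule.add_mem_sup h ⟨g (q z), rfl⟩
  refine ⟨_, HasSmoothSliceAt.of_contDiff (W := W ⊔ R) hf hf' hfS ?_, ?_⟩
  · have hcont : Filter.Tendsto π (nhds S) (nhds S) := by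
      have := π.continuous.tendsto S
      rwa [hπS] at this
    filter_upwards [hcont.eventually hloc] with z hz
    rw [hfT, hmem]
    exact hz (Submodule.projection_apply_mem hc.symm z)
  · have h1 := Submodule.finrank_sup_add_finrank_inf_eq W R
    have h2 : W ⊓ R = ⊥ := (hc.symm.disjoint.mono_left hW).eq_bot
    have h3 := Submodule.finrank_add_eq_of_isCompl hc
    rw [_root_.Module.finrank_matrix, finrank_self, mul_one] at h3
    rw [h2, finrank_bot] at h1
    omega

end Matrix

/-! ### The normal space at a block scalar matrix, and spectral lemmas -/

namespace Matrix

open LinearMap in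
theorem rank_fromBlocks_zero_zero {K ι₁ ι₂ κ₁ κ₂ : Type*} [Field K] [Fintype ι₁] [Fintype ι₂]
    [Fintype κ₁] [Fintype κ₂] (A : Matrix ι₁ κ₁ K) (D : Matrix ι₂ κ₂ K) :
    (fromBlocks A 0 0 D).rank = A.rank + D.rank := by
  have h : (fromBlocks A 0 0 D).mulVecLin =
      ((LinearEquiv.sumArrowLequivProdArrow ι₁ ι₂ K K).symm : _ →ₗ[K] _) ∘ₗ
        ((range A.mulVecLin).subtype.prodMap (range D.mulVecLin).subtype ∘ₗ
          A.mulVecLin.rangeRestrict.prodMap D.mulVecLin.rangeRestrict) ∘ₗ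
        (LinearEquiv.sumArrowLequivProdArrow κ₁ κ₂ K K : _ →ₗ[K] _) := by
    refine LinearMap.ext fun v ↦ ?_
    ext i
    rcases i with i | i <;> simp [fromBlocks_mulVec] <;> rfl
  rw [rank, h, range_comp, range_comp_of_range_eq_top _ (LinearEquiv.range _),
    range_comp_of_range_eq_top, LinearEquiv.finrank_map_eq, finrank_range_of_inj,
    _root_.Module.finrank_prod, rank, rank]
  · rw [coe_prodMap]
    exact Function.Injective.prodMap Subtype.val_injective Subtype.val_injective
  · rw [range_prodMap, range_rangeRestrict, range_rangeRestrict, Submodule.prod_top]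

theorem eq_zero_of_rank_eq_zero {K ι κ : Type*} [Field K] [Fintype ι] [Fintype κ] [DecidableEq κ]
    {A : Matrix ι κ K} (h : A.rank = 0) : A = 0 := by
  rw [rank, Submodule.finrank_eq_zero, LinearMap.range_eq_bot] at h
  exact ext_of_mulVec_single fun i ↦ by
    rw [zero_mulVec]
    exact LinearMap.congr_fun h (Pi.single i 1)

variable {J ι κ : Type*} [Fintype J] [DecidableEq J] [Fintype ι] [Fintype κ] [DecidableEq ι]
  [DecidableEq κ] {k : J → ℕ}

/-- The block matrix with diagonal blocks `σ j • 1` of size `k j` and zeros elsewhere, as a linear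
function of `σ`. -/
def blockSigma (ι κ : Type*) (k : J → ℕ) :
    (J → ℝ) →ₗ[ℝ] Matrix ((Σ j, Fin (k j)) ⊕ ι) ((Σ j, Fin (k j)) ⊕ κ) ℝ where
  toFun σ := fromBlocks (diagonal fun a ↦ σ a.1) 0 0 0
  map_add' σ τ := by simp [fromBlocks_add]
  map_smul' c σ := by
    simp only [fromBlocks_smul, smul_zero, ← diagonal_smul, RingHom.id_apply]
    rfl

omit [Fintype J] [Fintype ι] [Fintype κ] [DecidableEq ι] [DecidableEq κ] in
theorem blockSigma_apply (σ : J → ℝ) :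
    blockSigma ι κ k σ = fromBlocks (diagonal fun a ↦ σ a.1) 0 0 0 := rfl

omit [Fintype J] [Fintype ι] [Fintype κ] [DecidableEq ι] [DecidableEq κ] in
theorem blockSigma_injective (hk : ∀ j, 1 ≤ k j) : Function.Injective (blockSigma ι κ k) := by
  intro σ τ h
  ext j
  have := congrFun (congrFun h (Sum.inl ⟨j, ⟨0, hk j⟩⟩)) (Sum.inl ⟨j, ⟨0, hk j⟩⟩)
  simpa [blockSigma_apply] using this

/-- Symmetric matrices, encoded by functions on unordered pairs, on the diagonal blocks and an
arbitrary matrix in the remaining corner. -/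
def symmBlocks (ι κ : Type*) (k : J → ℕ) :
    ((∀ j, Sym2 (Fin (k j)) → ℝ) × Matrix ι κ ℝ) →ₗ[ℝ]
      Matrix ((Σ j, Fin (k j)) ⊕ ι) ((Σ j, Fin (k j)) ⊕ κ) ℝ where
  toFun p := fromBlocks (blockDiagonal' fun j ↦ of fun a b ↦ p.1 j s(a, b)) 0 0 p.2
  map_add' p q := by
    rw [fromBlocks_add, ← blockDiagonal'_add]
    simp only [add_zero]
    rfl
  map_smul' c p := by
    rw [fromBlocks_smul, ← blockDiagonal'_smul]
    simp only [smul_zero]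
    rfl

omit [Fintype J] [Fintype ι] [Fintype κ] [DecidableEq ι] [DecidableEq κ] in
theorem symmBlocks_apply (p : (∀ j, Sym2 (Fin (k j)) → ℝ) × Matrix ι κ ℝ) :
    symmBlocks ι κ k p =
      fromBlocks (blockDiagonal' fun j ↦ of fun a b ↦ p.1 j s(a, b)) 0 0 p.2 := rfl

theorem symmBlocks_injective : Function.Injective (symmBlocks ι κ k) := by
  rintro ⟨f, D⟩ ⟨g, D'⟩ h
  rw [symmBlocks_apply, symmBlocks_apply, fromBlocks_inj] at h
  obtain ⟨h1, -, -, rfl⟩ := h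
  refine Prod.ext (funext fun j ↦ funext fun z ↦ ?_) rfl
  induction z with | _ a b
  exact congrFun (congrFun (congrFun (blockDiagonal'_injective h1) j) a) b

/-- In the upper left block `P`, the two symmetry conditions combine to `(P b a - P a b) * (σ a + σ
b) = 0`, so positivity makes `P` symmetric; then `P a b * (σ a - σ b) = 0` kills entries between
different blocks. Positivity also kills the two off-diagonal rectangles, while the last corner is
unconstrained. -/
theorem range_symmBlocks {σ : J → ℝ} (hσ : Function.Injective σ) (hpos : ∀ j, 0 < σ j) :
    LinearMap.range (symmBlocks ι κ k) = orbitNormal (blockSigma ι κ k σ) := by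
  ext B
  rw [← fromBlocks_toBlocks B, mem_orbitNormal, blockSigma_apply]
  simp only [fromBlocks_transpose, diagonal_transpose, transpose_zero, fromBlocks_multiply,
    Matrix.mul_zero, add_zero, IsSymm]
  rw [fromBlocks_inj, fromBlocks_inj]
  set P := B.toBlocks₁₁
  set Q := B.toBlocks₁₂
  set R := B.toBlocks₂₁
  set D := B.toBlocks₂₂
  constructor
  · rintro ⟨⟨f, D'⟩, h⟩
    rw [symmBlocks_apply, fromBlocks_inj] at h
    obtain ⟨h1, h2, h3, h4⟩ := h
    have hPs : Pᵀ = P := by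
      rw [← h1, blockDiagonal'_transpose]
      congr 1
      ext j a b
      simp [Sym2.eq_swap]
    have hPc : diagonal (fun a : Σ j, Fin (k j) ↦ σ a.1) * P = P * diagonal fun a ↦ σ a.1 := by
      rw [← h1]
      ext ⟨i, a⟩ ⟨j, b⟩
      by_cases hij : i = j
      · subst hij
        simp [mul_comm]
      · simp [blockDiagonal'_apply_ne _ _ _ hij]
    simp [← h2, ← h3, transpose_mul, hPs, hPc]
  · rintro ⟨⟨h1, -, h3, -⟩, ⟨h4, -, h6, -⟩⟩
    have hP1 (a b) : P b a * σ a.1 = P a b * σ b.1 := by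
      simpa using congrFun (congrFun h1 a) b
    have hP2 (a b) : P a b * σ a.1 = P b a * σ b.1 := by
      simpa using congrFun (congrFun h4 a) b
    have hR : R = 0 := by
      ext i b
      have := congrFun (congrFun h3 i) b
      simpa [(hpos b.1).ne'] using this
    have hQ : Q = 0 := by
      ext b i
      have := congrFun (congrFun h6 i) b
      simpa [(hpos b.1).ne'] using this
    have hPs (a b) : P b a = P a b := by
      have ha := hpos a.1
      have hb := hpos b.1
      have h1 := hP1 a b
      have h2 := hP2 a b
      have : (P b a - P a b) * (σ a.1 + σ b.1) = 0 := by linarith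
      rcases mul_eq_zero.mp this with h | h <;> linarith
    have hP0 (a b) (hab : a.1 ≠ b.1) : P a b = 0 := by
      have h1 := hP1 a b
      rw [hPs, ← sub_eq_zero, ← mul_sub] at h1
      exact (mul_eq_zero.mp h1).resolve_right (sub_ne_zero.mpr (hσ.ne hab))
    refine ⟨⟨fun j ↦ Sym2.lift ⟨fun a b ↦ P ⟨j, a⟩ ⟨j, b⟩, fun a b ↦ hPs _ _⟩, D⟩, ?_⟩
    rw [symmBlocks_apply, fromBlocks_inj]
    refine ⟨?_, hQ.symm, hR.symm, rfl⟩
    ext ⟨i, a⟩ ⟨j, b⟩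
    by_cases hij : i = j
    · subst hij
      simp
    · rw [blockDiagonal'_apply_ne _ _ _ hij, hP0 _ _ hij]

open _root_.Module in
theorem finrank_orbitNormal_blockSigma {σ : J → ℝ} (hσ : Function.Injective σ)
    (hpos : ∀ j, 0 < σ j) : finrank ℝ (orbitNormal (blockSigma ι κ k σ)) =
      ∑ j, (k j + 1).choose 2 + Fintype.card ι * Fintype.card κ := by
  rw [← range_symmBlocks hσ hpos, LinearMap.finrank_range_of_inj symmBlocks_injective,
    finrank_prod, finrank_pi_fintype, finrank_matrix, finrank_self, mul_one]
  simp [Sym2.card]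

theorem blockDiagonal'_mulVec (C : ∀ j, Matrix (Fin (k j)) (Fin (k j)) ℝ)
    (w : ∀ j, Fin (k j) → ℝ) :
    blockDiagonal' C *ᵥ (fun a ↦ w a.1 a.2) = fun a ↦ (C a.1 *ᵥ w a.1) a.2 := by
  ext ⟨i, a⟩
  rw [mulVec, dotProduct, Fintype.sum_sigma, Finset.sum_eq_single i]
  · simp [mulVec, dotProduct]
  · intro j _ hj
    simp [blockDiagonal'_apply_ne _ _ _ (Ne.symm hj)]
  · simp

/-- The eigenvalues of the blocks are singular values. -/
theorem exists_eq_of_blockDiagonal_eq {C : ∀ j, Matrix (Fin (k j)) (Fin (k j)) ℝ}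
    (hC : ∀ j, (C j).IsSymm) {τ : J → ℝ} (hτ : ∀ j, 0 < τ j)
    {U : Matrix ((Σ j, Fin (k j)) ⊕ ι) ((Σ j, Fin (k j)) ⊕ ι) ℝ}
    {V : Matrix ((Σ j, Fin (k j)) ⊕ κ) ((Σ j, Fin (k j)) ⊕ κ) ℝ}
    (hU : U ∈ orthogonalGroup _ ℝ) (hV : V ∈ orthogonalGroup _ ℝ)
    (h : fromBlocks (blockDiagonal' C) 0 0 0 = U * blockSigma ι κ k τ * Vᵀ)
    {j : J} {v : Fin (k j) → ℝ} (hv : v ≠ 0) {c : ℝ} (hc : 0 < c) (hvc : C j *ᵥ v = c • v) :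
    ∃ i, c = τ i := by
  rw [mem_orthogonalGroup_iff'] at hU hV
  let w : (Σ j, Fin (k j)) → ℝ := fun a ↦ Pi.single (M := fun j ↦ Fin (k j) → ℝ) j v a.1 a.2
  have hw : blockDiagonal' C *ᵥ w = c • w := by
    rw [blockDiagonal'_mulVec]
    ext ⟨i, a⟩
    by_cases hij : i = j
    · subst hij
      simp [w, hvc]
    · simp [w, hij]
  set D : Matrix ((Σ j, Fin (k j)) ⊕ ι) ((Σ j, Fin (k j)) ⊕ κ) ℝ :=
    fromBlocks (blockDiagonal' C) 0 0 0 with hD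
  have hsymm : (blockDiagonal' C)ᵀ = blockDiagonal' C := by
    rw [blockDiagonal'_transpose]
    congr 1
    exact funext fun j ↦ hC j
  let x : (Σ j, Fin (k j)) ⊕ κ → ℝ := Sum.elim w 0
  -- Passing to `Dᵀ * D` eliminates `U`. Conjugation by `V` then makes the matrix diagonal with
  -- entries `τ i ^ 2` and `0`, and any nonzero coordinate of `Vᵀ *ᵥ x` identifies `c ^ 2`.
  have hx : (Dᵀ * D) *ᵥ x = (c ^ 2) • x := by
    rw [hD, fromBlocks_transpose, fromBlocks_multiply, fromBlocks_mulVec, hsymm]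
    have : (blockDiagonal' C * blockDiagonal' C) *ᵥ w = (c ^ 2) • w := by
      rw [← mulVec_mulVec, hw, mulVec_smul, hw, smul_smul, sq]
    ext (a | a) <;> simp [x, this]
  have hx0 : x ≠ 0 := by
    intro h0
    refine hv (funext fun a ↦ ?_)
    simpa [x, w] using congrFun h0 (Sum.inl ⟨j, a⟩)
  have hy : ((blockSigma ι κ k τ)ᵀ * blockSigma ι κ k τ) *ᵥ (Vᵀ *ᵥ x) = (c ^ 2) • (Vᵀ *ᵥ x) := by
    rw [← mulVec_smul, ← hx, h]
    simp only [mulVec_mulVec, transpose_mul, transpose_transpose, Matrix.mul_assoc]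
    rw [← Matrix.mul_assoc Vᵀ V, show Vᵀ * V = 1 from hV, Matrix.one_mul, ← Matrix.mul_assoc Uᵀ U,
      show Uᵀ * U = 1 from hU, Matrix.one_mul]
  obtain ⟨b, hb⟩ : ∃ b, (Vᵀ *ᵥ x) b ≠ 0 := by
    by_contra! hne
    refine hx0 ?_
    rw [← one_mulVec x, ← show V * Vᵀ = 1 from mul_eq_one_comm.mp hV, ← mulVec_mulVec,
      show Vᵀ *ᵥ x = 0 from funext hne, mulVec_zero]
  have hb' := congrFun hy b
  rw [blockSigma_apply, fromBlocks_transpose, fromBlocks_multiply,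
    fromBlocks_mulVec] at hb'
  rcases b with a | a
  · refine ⟨a.1, ?_⟩
    have h1 : τ a.1 ^ 2 = c ^ 2 := by
      refine mul_right_cancel₀ hb ?_
      simpa [mulVec_diagonal, sq] using hb'
    exact ((sq_eq_sq₀ (hτ a.1).le hc.le).mp h1).symm
  · simp [hc.ne'] at hb'
    exact absurd hb' hb

theorem IsSymm.eq_smul_one_of_eigenvalues_eq {C : Matrix ι ι ℝ} (hC : C.IsSymm) {c : ℝ}
    (h : ∀ v ≠ 0, ∀ t : ℝ, C *ᵥ v = t • v → t = c) : C = c • 1 := by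
  have hC' := isHermitian_iff_isSymm.mpr hC
  have he : hC'.eigenvalues = fun _ ↦ c := by
    ext i
    refine h _ ?_ _ (hC'.mulVec_eigenvectorBasis i)
    intro h0
    exact hC'.eigenvectorBasis.orthonormal.ne_zero i (by ext x; exact congrFun h0 x)
  rw [hC'.spectral_theorem, he]
  have : (diagonal (RCLike.ofReal ∘ fun _ : ι ↦ c) : Matrix ι ι ℝ) = c • 1 := by
    ext i j
    simp [diagonal_apply, one_apply]
  rw [this]
  simp

/-- Gershgorin's circle theorem: this replaces continuity of eigenvalues. -/
theorem eigenvalue_abs_sub_lt {C : Matrix ι ι ℝ} {s ε : ℝ}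
    (hC : ∀ i, |C i i - s| + ∑ l ∈ Finset.univ.erase i, |C i l| < ε) {v : ι → ℝ} (hv : v ≠ 0)
    {t : ℝ} (h : C *ᵥ v = t • v) : |t - s| < ε := by
  have := _root_.Module.End.hasEigenvalue_of_hasEigenvector (f := toLin' C) (μ := t) (x := v)
    ⟨_root_.Module.End.mem_eigenspace_iff.mpr (by simpa using h), hv⟩
  obtain ⟨i, hi⟩ := eigenvalue_mem_ball this
  rw [Metric.mem_closedBall, Real.dist_eq] at hi
  simp only [Real.norm_eq_abs] at hi
  have := abs_sub_le t (C i i) s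
  linarith [hC i]

end Matrix

/-- If the families `t j` of values lie in disjoint neighbourhoods and together take no more values
than there are families, each family is constant. -/
theorem eq_of_mem_range_of_abs_sub_lt {J : Type*} [Finite J] {P : J → Set ℝ}
    {σ τ : J → ℝ} {ε : ℝ} (hε : ∀ i j, i ≠ j → 2 * ε ≤ |σ i - σ j|)
    (hP : ∀ j, (P j).Nonempty) (hτ : ∀ j, ∀ t ∈ P j, ∃ i, t = τ i)
    (hσ : ∀ j, ∀ t ∈ P j, |t - σ j| < ε) {j : J} {t t' : ℝ} (ht : t ∈ P j) (ht' : t' ∈ P j) :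
    t = t' := by
  have huniq (i j) (t) (hi : t ∈ P i) (hj : t ∈ P j) : i = j := by
    by_contra hij
    have h1 := hσ i t hi
    have h2 := hσ j t hj
    have h3 := abs_sub_le (σ i) t (σ j)
    rw [abs_sub_comm (σ i) t] at h3
    linarith [hε i j hij]
  choose p hp using hP
  choose f hf using fun j ↦ hτ j (p j) (hp j)
  -- Choosing one value per family injects the finite index set into itself, hence bijectively;
  -- every `τ i` is used up by a chosen value.
  have hinj : Function.Injective f := fun i j hij ↦ by
    refine huniq i j (p i) (hp i) ?_
    rw [hf i, hij, ← hf j]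
    exact hp j
  have key (s) (hs : s ∈ P j) : s = p j := by
    obtain ⟨i, hi⟩ := hτ j s hs
    obtain ⟨l, rfl⟩ := Finite.injective_iff_surjective.mp hinj i
    rw [← hf l] at hi
    rw [huniq j l s hs (hi ▸ hp l), hi]
  rw [key t ht, key t' ht']

/-! ### The two sets inside the normal space near a block scalar matrix -/

namespace Matrix

variable {J ι κ : Type*} [Fintype J] [Fintype ι] [Fintype κ] [DecidableEq ι]
  [DecidableEq κ] {k : J → ℕ}

theorem rank_blockSigma [DecidableEq J] {σ : J → ℝ} (hσ : ∀ j, σ j ≠ 0) :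
    (blockSigma ι κ k σ).rank = ∑ j, k j := by
  have : IsUnit (diagonal fun a : Σ j, Fin (k j) ↦ σ a.1) := by
    rw [isUnit_iff_isUnit_det, det_diagonal, isUnit_iff_ne_zero, Finset.prod_ne_zero_iff]
    exact fun a _ ↦ hσ a.1
  rw [blockSigma_apply, rank_fromBlocks_zero_zero, rank_of_isUnit _ this, rank_zero, add_zero]
  simp

theorem rank_orthogonal_mul_mul {A : Matrix ι κ ℝ} {U : Matrix ι ι ℝ} {V : Matrix κ κ ℝ}
    (hU : U ∈ orthogonalGroup ι ℝ) (hV : V ∈ orthogonalGroup κ ℝ) : (U * A * Vᵀ).rank = A.rank := by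
  rw [mem_orthogonalGroup_iff] at hU hV
  rw [rank_mul_eq_left_of_isUnit_det, rank_mul_eq_right_of_isUnit_det]
  · exact isUnit_det_of_right_inverse hU
  · rw [det_transpose]
    exact isUnit_det_of_right_inverse hV

/-- The upper left block stays invertible near `Σ` and already contributes the full rank, so the
other corner must have rank zero. -/
theorem eventually_rank_symmBlocks [DecidableEq J] {σ : J → ℝ} (hσ : ∀ j, σ j ≠ 0) :
    ∀ᶠ D in nhds (blockSigma ι κ k σ), ∀ p, D = symmBlocks ι κ k p →
      (D.rank = ∑ j, k j ↔ p.2 = 0) := by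
  have hc : Continuous fun D : Matrix ((Σ j, Fin (k j)) ⊕ ι) ((Σ j, Fin (k j)) ⊕ κ) ℝ ↦
      (D.submatrix Sum.inl Sum.inl).det := (continuous_id.matrix_submatrix _ _).matrix_det
  have h0 : ((blockSigma ι κ k σ).submatrix Sum.inl Sum.inl).det ≠ 0 := by
    change (diagonal _).det ≠ 0
    rw [det_diagonal, Finset.prod_ne_zero_iff]
    exact fun a _ ↦ hσ a.1
  filter_upwards [hc.continuousAt.eventually_ne h0] with D hD p hDp
  rw [hDp, symmBlocks_apply] at hD ⊢
  change (blockDiagonal' fun j ↦ of fun a b ↦ p.1 j s(a, b)).det ≠ 0 at hD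
  rw [rank_fromBlocks_zero_zero, rank_of_isUnit _
    ((isUnit_iff_isUnit_det _).mpr (isUnit_iff_ne_zero.mpr hD))]
  simp only [Fintype.card_sigma, Fintype.card_fin, Nat.add_eq_left]
  exact ⟨eq_zero_of_rank_eq_zero, fun h ↦ by rw [h, rank_zero]⟩

/-- The matrices with distinct nonzero singular values `σ j` of multiplicities `k j`. -/
def blockOrbit (ι κ : Type*) [Fintype ι] [Fintype κ] [DecidableEq ι] [DecidableEq κ]
    [LinearOrder J] (k : J → ℕ) :
    Set (Matrix ((Σ j, Fin (k j)) ⊕ ι) ((Σ j, Fin (k j)) ⊕ κ) ℝ) :=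
  {A | ∃ σ : J → ℝ, StrictAnti σ ∧ (∀ j, 0 < σ j) ∧
    ∃ U ∈ orthogonalGroup ((Σ j, Fin (k j)) ⊕ ι) ℝ, ∃ V ∈ orthogonalGroup ((Σ j, Fin (k j)) ⊕ κ) ℝ,
      A = U * blockSigma ι κ k σ * Vᵀ}

variable [LinearOrder J]

theorem mul_mul_mem_blockOrbit {U : Matrix ((Σ j, Fin (k j)) ⊕ ι) ((Σ j, Fin (k j)) ⊕ ι) ℝ}
    {V : Matrix ((Σ j, Fin (k j)) ⊕ κ) ((Σ j, Fin (k j)) ⊕ κ) ℝ}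
    {A : Matrix ((Σ j, Fin (k j)) ⊕ ι) ((Σ j, Fin (k j)) ⊕ κ) ℝ}
    (hU : U ∈ orthogonalGroup _ ℝ) (hV : V ∈ orthogonalGroup _ ℝ)
    (hA : A ∈ blockOrbit ι κ k) : U * A * Vᵀ ∈ blockOrbit ι κ k := by
  obtain ⟨σ, h1, h2, U', hU', V', hV', rfl⟩ := hA
  exact ⟨σ, h1, h2, U * U', mul_mem hU hU', V * V', mul_mem hV hV', by
    simp only [transpose_mul, Matrix.mul_assoc]⟩

theorem rank_of_mem_blockOrbit {A : Matrix ((Σ j, Fin (k j)) ⊕ ι) ((Σ j, Fin (k j)) ⊕ κ) ℝ}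
    (hA : A ∈ blockOrbit ι κ k) : A.rank = ∑ j, k j := by
  obtain ⟨σ, -, h2, U, hU, V, hV, rfl⟩ := hA
  rw [rank_orthogonal_mul_mul hU hV, rank_blockSigma fun j ↦ (h2 j).ne']

/-- Positivity and strict order of the block scalars are open conditions, read off from the first
diagonal entry of each block. -/
theorem eventually_mem_blockOrbit_of_range_blockSigma (hk : ∀ j, 1 ≤ k j) {σ : J → ℝ}
    (hσ : StrictAnti σ) (hpos : ∀ j, 0 < σ j) :
    ∀ᶠ D in nhds (blockSigma ι κ k σ), D ∈ LinearMap.range (blockSigma ι κ k) →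
      D ∈ blockOrbit ι κ k := by
  let a : J → (Σ j, Fin (k j)) := fun j ↦ ⟨j, ⟨0, hk j⟩⟩
  have hc (j : J) : Continuous
      fun D : Matrix ((Σ j, Fin (k j)) ⊕ ι) ((Σ j, Fin (k j)) ⊕ κ) ℝ ↦
        D (Sum.inl (a j)) (Sum.inl (a j)) := continuous_id.matrix_elem _ _
  have hv (s : J → ℝ) (j) : blockSigma ι κ k s (Sum.inl (a j)) (Sum.inl (a j)) = s j := by
    simp [blockSigma_apply, a]
  have h1 : ∀ᶠ D in nhds (blockSigma ι κ k σ), ∀ j, 0 < D (Sum.inl (a j)) (Sum.inl (a j)) := by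
    refine Filter.eventually_all.mpr fun j ↦ (hc j).continuousAt.eventually_const_lt ?_
    exact (hpos j).trans_eq (hv σ j).symm
  have h2 : ∀ᶠ D in nhds (blockSigma ι κ k σ), ∀ i j, i < j →
      D (Sum.inl (a j)) (Sum.inl (a j)) < D (Sum.inl (a i)) (Sum.inl (a i)) := by
    refine Filter.eventually_all.mpr fun i ↦ Filter.eventually_all.mpr fun j ↦ ?_
    by_cases hij : i < j
    · refine ((hc j).continuousAt.eventually_lt (hc i).continuousAt ?_).mono fun D hD _ ↦ hD
      rw [hv, hv]
      exact hσ hij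
    · exact Filter.Eventually.of_forall fun _ h ↦ absurd h hij
  filter_upwards [h1, h2] with D hD1 hD2
  rintro ⟨s, rfl⟩
  simp only [hv] at hD1 hD2
  exact ⟨s, fun i j hij ↦ hD2 i j hij, hD1, 1, one_mem _, 1, one_mem _, by simp⟩

theorem exists_separation (σ : J → ℝ) (hσ : Function.Injective σ) (hpos : ∀ j, 0 < σ j) :
    ∃ ε > 0, (∀ j, ε < σ j) ∧ ∀ i j, i ≠ j → 2 * ε ≤ |σ i - σ j| := by
  have h1 : ∀ᶠ ε : ℝ in nhdsWithin 0 (Set.Ioi 0), ∀ j, ε < σ j :=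
    Filter.eventually_all.mpr fun j ↦ nhdsWithin_le_nhds (eventually_lt_nhds (hpos j))
  have h2 : ∀ᶠ ε : ℝ in nhdsWithin 0 (Set.Ioi 0), ∀ i j, i ≠ j → 2 * ε ≤ |σ i - σ j| := by
    refine Filter.eventually_all.mpr fun i ↦ Filter.eventually_all.mpr fun j ↦ ?_
    by_cases hij : i = j
    · exact Filter.Eventually.of_forall fun _ h ↦ absurd hij h
    · have : 0 < |σ i - σ j| / 2 := half_pos (abs_pos.mpr (sub_ne_zero.mpr (hσ.ne hij)))
      filter_upwards [nhdsWithin_le_nhds (eventually_lt_nhds this)] with ε hε _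
      linarith
  obtain ⟨ε, ⟨h3, h4⟩, h5⟩ := ((h1.and h2).and self_mem_nhdsWithin).exists
  exact ⟨ε, h5, h3, h4⟩

theorem eventually_mem_range_blockSigma (hk : ∀ j, 1 ≤ k j) {σ : J → ℝ}
    (hσ : StrictAnti σ) (hpos : ∀ j, 0 < σ j) :
    ∀ᶠ D in nhds (blockSigma ι κ k σ), D ∈ LinearMap.range (symmBlocks ι κ k) →
      D ∈ blockOrbit ι κ k → D ∈ LinearMap.range (blockSigma ι κ k) := by
  obtain ⟨ε, hε0, hε1, hε2⟩ := exists_separation σ hσ.injective hpos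
  have hc (a b) : Continuous
      fun D : Matrix ((Σ j, Fin (k j)) ⊕ ι) ((Σ j, Fin (k j)) ⊕ κ) ℝ ↦ D a b :=
    continuous_id.matrix_elem _ _
  have h1 : ∀ᶠ D in nhds (blockSigma ι κ k σ), ∀ (j : J) (i : Fin (k j)),
      |D (Sum.inl ⟨j, i⟩) (Sum.inl ⟨j, i⟩) - σ j| +
        ∑ l ∈ Finset.univ.erase i, |D (Sum.inl ⟨j, i⟩) (Sum.inl ⟨j, l⟩)| < ε := by
    refine Filter.eventually_all.mpr fun j ↦ Filter.eventually_all.mpr fun i ↦ ?_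
    have hcont : Continuous
        fun D : Matrix ((Σ j, Fin (k j)) ⊕ ι) ((Σ j, Fin (k j)) ⊕ κ) ℝ ↦
        |D (Sum.inl ⟨j, i⟩) (Sum.inl ⟨j, i⟩) - σ j| +
          ∑ l ∈ Finset.univ.erase i, |D (Sum.inl ⟨j, i⟩) (Sum.inl ⟨j, l⟩)| :=
      ((hc _ _).sub continuous_const).abs.add (continuous_finsetSum _ fun l _ ↦ (hc _ _).abs)
    refine hcont.continuousAt.eventually_lt_const ?_
    have : ∑ l ∈ Finset.univ.erase i,
        |blockSigma ι κ k σ (Sum.inl ⟨j, i⟩) (Sum.inl ⟨j, l⟩)| = 0 := by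
      refine Finset.sum_eq_zero fun l hl ↦ ?_
      have : i ≠ l := (Finset.ne_of_mem_erase hl).symm
      simp [blockSigma_apply, this]
    change |blockSigma ι κ k σ _ _ - σ j| + ∑ l ∈ Finset.univ.erase i,
        |blockSigma ι κ k σ (Sum.inl ⟨j, i⟩) (Sum.inl ⟨j, l⟩)| < ε
    rw [this]
    simpa [blockSigma_apply] using hε0
  filter_upwards [h1, eventually_rank_symmBlocks (ι := ι) (κ := κ) (k := k)
    fun j ↦ (hpos j).ne'] with D hD hrank
  rintro ⟨⟨f, D'⟩, rfl⟩ horb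
  have hD' : D' = 0 := (hrank _ rfl).mp (rank_of_mem_blockOrbit horb)
  subst hD'
  obtain ⟨τ, -, hτ, U, hU, V, hV, h⟩ := horb
  rw [symmBlocks_apply] at hD ⊢
  rw [symmBlocks_apply] at h
  set C : ∀ j, Matrix (Fin (k j)) (Fin (k j)) ℝ := fun j ↦ of fun a b ↦ f j s(a, b) with hCdef
  have hC (j) : (C j).IsSymm := by
    ext a b
    simp [hCdef, Sym2.eq_swap]
  have hclose (j) (v : Fin (k j) → ℝ) (hv : v ≠ 0) (t : ℝ) (ht : C j *ᵥ v = t • v) :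
      |t - σ j| < ε := by
    refine eigenvalue_abs_sub_lt (fun i ↦ ?_) hv ht
    simpa using hD j i
  let P : J → Set ℝ := fun j ↦ {t | ∃ v ≠ 0, C j *ᵥ v = t • v}
  have hP (j) : (P j).Nonempty := by
    have hC' := isHermitian_iff_isSymm.mpr (hC j)
    let i : Fin (k j) := ⟨0, hk j⟩
    exact ⟨_, _, fun h0 ↦ hC'.eigenvectorBasis.orthonormal.ne_zero i
      (by ext x; exact congrFun h0 x), hC'.mulVec_eigenvectorBasis i⟩
  have hPτ (j) (t) (ht : t ∈ P j) : ∃ i, t = τ i := by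
    obtain ⟨v, hv, hvt⟩ := ht
    have h2 := hclose j v hv t hvt
    -- Positivity matters: a negative eigenvalue would be a singular value only up to sign.
    have h3 : 0 < t := by linarith [(abs_lt.mp h2).1, hε1 j]
    exact exists_eq_of_blockDiagonal_eq hC hτ hU hV h hv h3 hvt
  have hPσ (j) (t) (ht : t ∈ P j) : |t - σ j| < ε := by
    obtain ⟨v, hv, hvt⟩ := ht
    exact hclose j v hv t hvt
  choose s hs using hP
  refine ⟨s, ?_⟩
  rw [blockSigma_apply, fromBlocks_inj]
  refine ⟨?_, rfl, rfl, rfl⟩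
  have hCs (j) : C j = s j • 1 := (hC j).eq_smul_one_of_eigenvalues_eq fun v hv t ht ↦
    eq_of_mem_range_of_abs_sub_lt hε2 (fun j ↦ ⟨s j, hs j⟩) hPτ hPσ (j := j) ⟨v, hv, ht⟩ (hs j)
  rw [show C = fun j ↦ diagonal fun _ ↦ s j from
    funext fun j ↦ by rw [hCs, smul_one_eq_diagonal], blockDiagonal'_diagonal]

theorem range_blockSigma_le : LinearMap.range (blockSigma ι κ k) ≤
    LinearMap.range (symmBlocks ι κ k) := by
  rintro _ ⟨s, rfl⟩
  refine ⟨⟨fun j ↦ Sym2.lift ⟨fun a b ↦ if a = b then s j else 0, fun a b ↦ by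
    simp only [eq_comm]⟩, 0⟩, ?_⟩
  rw [symmBlocks_apply, blockSigma_apply, fromBlocks_inj]
  refine ⟨?_, rfl, rfl, rfl⟩
  rw [← blockDiagonal'_diagonal fun j (_ : Fin (k j)) ↦ s j]
  congr 1

open _root_.Module in
theorem hasSmoothSliceAt_blockOrbit (hk : ∀ j, 1 ≤ k j) {σ : J → ℝ}
    (hσ : StrictAnti σ) (hpos : ∀ j, 0 < σ j) :
    ∃ d, HasSmoothSliceAt (blockOrbit ι κ k) d (blockSigma ι κ k σ) ∧
      d + (∑ j, (k j + 1).choose 2 + Fintype.card ι * Fintype.card κ) =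
        (∑ j, k j + Fintype.card ι) * (∑ j, k j + Fintype.card κ) + Fintype.card J := by
  have hr := range_symmBlocks (ι := ι) (κ := κ) (k := k) hσ.injective hpos
  obtain ⟨d, hd, hd'⟩ := hasSmoothSliceAt_of_orthogonal_invariant (T := blockOrbit ι κ k)
    (S := blockSigma ι κ k σ) (W := LinearMap.range (blockSigma ι κ k))
    (hr ▸ range_blockSigma_le) (fun U hU V hV A hA ↦ mul_mul_mem_blockOrbit hU hV hA) (by
      filter_upwards [eventually_mem_range_blockSigma (ι := ι) (κ := κ) hk hσ hpos,
        eventually_mem_blockOrbit_of_range_blockSigma (ι := ι) (κ := κ) hk hσ hpos] with D h1 h2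
      rw [← hr]
      exact fun h ↦ ⟨h1 h, h2⟩)
  refine ⟨d, hd, ?_⟩
  rw [finrank_orbitNormal_blockSigma hσ.injective hpos,
    LinearMap.finrank_range_of_inj (blockSigma_injective hk), finrank_fintype_fun_eq_card] at hd'
  simpa using hd'

open _root_.Module in
theorem hasSmoothSliceAt_rank {σ : J → ℝ} (hσ : Function.Injective σ) (hpos : ∀ j, 0 < σ j) :
    ∃ d, HasSmoothSliceAt {A : Matrix ((Σ j, Fin (k j)) ⊕ ι) ((Σ j, Fin (k j)) ⊕ κ) ℝ |
        A.rank = ∑ j, k j} d (blockSigma ι κ k σ) ∧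
      d + Fintype.card ι * Fintype.card κ =
        (∑ j, k j + Fintype.card ι) * (∑ j, k j + Fintype.card κ) := by
  have hr := range_symmBlocks (ι := ι) (κ := κ) (k := k) hσ hpos
  obtain ⟨d, hd, hd'⟩ := hasSmoothSliceAt_of_orthogonal_invariant
    (T := {A : Matrix ((Σ j, Fin (k j)) ⊕ ι) ((Σ j, Fin (k j)) ⊕ κ) ℝ | A.rank = ∑ j, k j})
    (S := blockSigma ι κ k σ)
    (W := LinearMap.range (symmBlocks ι κ k ∘ₗ LinearMap.inl ℝ _ _))
    (hr ▸ LinearMap.range_comp_le_range _ _)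
    (fun U hU V hV A hA ↦ (rank_orthogonal_mul_mul hU hV).trans hA) (by
      filter_upwards [eventually_rank_symmBlocks (ι := ι) (κ := κ) (k := k)
        fun j ↦ (hpos j).ne'] with D h1
      rw [← hr]
      rintro ⟨⟨f, D'⟩, rfl⟩
      refine (h1 _ rfl).trans ?_
      constructor
      · rintro rfl
        exact ⟨f, rfl⟩
      · rintro ⟨g, hg⟩
        exact (congrArg Prod.snd (symmBlocks_injective hg)).symm)
  refine ⟨d, hd, ?_⟩
  rw [finrank_orbitNormal_blockSigma hσ hpos, LinearMap.finrank_range_of_inj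
    (f := symmBlocks ι κ k ∘ₗ LinearMap.inl ℝ _ _)
    (symmBlocks_injective.comp LinearMap.inl_injective), finrank_pi_fintype] at hd'
  simp [Sym2.card] at hd'
  linarith

end Matrix

/-! ### From normal forms to all points, and from blocks to `Fin n` -/

namespace Matrix

section

variable {J ι κ : Type*} [Fintype J] [Fintype ι] [Fintype κ] [DecidableEq ι]
  [DecidableEq κ] [LinearOrder J] {k : J → ℕ}

theorem isSmoothSubmanifold_blockOrbit (hk : ∀ j, 1 ≤ k j) {d : ℕ}
    (hd : d + (∑ j, (k j + 1).choose 2 + Fintype.card ι * Fintype.card κ) =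
      (∑ j, k j + Fintype.card ι) * (∑ j, k j + Fintype.card κ) + Fintype.card J) :
    IsSmoothSubmanifold (blockOrbit ι κ k) d := by
  rintro A ⟨σ, hσ, hpos, U, hU, V, hV, rfl⟩
  obtain ⟨d', h, hd'⟩ := hasSmoothSliceAt_blockOrbit (ι := ι) (κ := κ) hk hσ hpos
  obtain rfl : d = d' := by omega
  have hU' := Unitary.star_mem hU
  have hV' := Unitary.star_mem hV
  have h1 : star U * U = 1 := Unitary.star_mul_self_of_mem hU
  have h2 : U * star U = 1 := Unitary.mul_star_self_of_mem hU
  have h3 : Vᵀ * V = 1 := Unitary.star_mul_self_of_mem hV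
  have h4 : V * Vᵀ = 1 := Unitary.mul_star_self_of_mem hV
  let e : Matrix ((Σ j, Fin (k j)) ⊕ ι) ((Σ j, Fin (k j)) ⊕ κ) ℝ ≃ₗ[ℝ]
      Matrix ((Σ j, Fin (k j)) ⊕ ι) ((Σ j, Fin (k j)) ⊕ κ) ℝ :=
    { toFun := fun X ↦ star U * X * V
      invFun := fun X ↦ U * X * Vᵀ
      map_add' := fun X Y ↦ by rw [Matrix.mul_add, Matrix.add_mul]
      map_smul' := fun c X ↦ by simp
      left_inv := fun X ↦ by
        change U * (star U * X * V) * Vᵀ = X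
        rw [← Matrix.mul_assoc, ← Matrix.mul_assoc, h2, Matrix.one_mul, Matrix.mul_assoc, h4,
          Matrix.mul_one]
      right_inv := fun X ↦ by
        change star U * (U * X * Vᵀ) * V = X
        rw [← Matrix.mul_assoc, ← Matrix.mul_assoc, h1, Matrix.one_mul, Matrix.mul_assoc, h3,
          Matrix.mul_one] }
  have heA : e (U * blockSigma ι κ k σ * Vᵀ) = blockSigma ι κ k σ := e.right_inv _
  rw [← heA] at h
  refine HasSmoothSliceAt.comap e.toContinuousLinearEquiv h fun X ↦ ⟨fun hX ↦ ?_, fun hX ↦ ?_⟩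
  · have := mul_mul_mem_blockOrbit hU' hV' hX
    rwa [star_eq_conjTranspose V, conjTranspose_eq_transpose_of_trivial,
      transpose_transpose] at this
  · have := mul_mul_mem_blockOrbit hU hV hX
    exact (e.left_inv X : U * e X * Vᵀ = X) ▸ this

/-- Rank-preserving linear automorphisms act transitively on matrices of a given rank, so the
existence of singular value decompositions is not needed. -/
theorem isSmoothSubmanifold_rank {σ : J → ℝ} (hσ : StrictAnti σ) (hpos : ∀ j, 0 < σ j) {d : ℕ}
    (hd : d + Fintype.card ι * Fintype.card κ =
        (∑ j, k j + Fintype.card ι) * (∑ j, k j + Fintype.card κ)) :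
    IsSmoothSubmanifold {A : Matrix ((Σ j, Fin (k j)) ⊕ ι) ((Σ j, Fin (k j)) ⊕ κ) ℝ |
      A.rank = ∑ j, k j} d := by
  intro A hA
  obtain ⟨d', h, hd'⟩ := hasSmoothSliceAt_rank (ι := ι) (κ := κ) (k := k) hσ.injective hpos
  obtain rfl : d = d' := by omega
  obtain ⟨e, heA, he⟩ := exists_linearEquiv_of_rank_eq (A := A) (B := blockSigma ι κ k σ)
    (hA.trans (rank_blockSigma fun j ↦ (hpos j).ne').symm)
  rw [← heA] at h
  refine HasSmoothSliceAt.comap e.toContinuousLinearEquiv h fun X ↦ ?_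
  change X.rank = _ ↔ (e X).rank = _
  rw [he]

end

variable {J : ℕ} {k : Fin J → ℕ}

/-- The first `∑ j, k j` indices sorted into blocks, followed by the remaining ones. -/
def blockIndexEquiv {n : ℕ} (k : Fin J → ℕ) (h : ∑ j, k j ≤ n) :
    Fin n ≃ (Σ j, Fin (k j)) ⊕ Fin (n - ∑ j, k j) :=
  (finCongr (Nat.add_sub_cancel' h).symm).trans
    (finSumFinEquiv.symm.trans (finSigmaFinEquiv.symm.sumCongr (Equiv.refl _)))

theorem blockIndexEquiv_symm_inl {n : ℕ} (h : ∑ j, k j ≤ n) (a : Σ j, Fin (k j)) :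
    ((blockIndexEquiv k h).symm (Sum.inl a) : ℕ) = finSigmaFinEquiv a := rfl

theorem blockIndexEquiv_symm_inr {n : ℕ} (h : ∑ j, k j ≤ n) (a : Fin (n - ∑ j, k j)) :
    ((blockIndexEquiv k h).symm (Sum.inr a) : ℕ) = ∑ j, k j + a := rfl

theorem reindex_singularValueMatrix {n m : ℕ} (hn : ∑ j, k j ≤ n) (hm : ∑ j, k j ≤ m)
    (σ : Fin J → ℝ) :
    reindex (blockIndexEquiv k hn) (blockIndexEquiv k hm) (singularValueMatrix n m k σ) =
      blockSigma _ _ k σ := by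
  ext a b
  rw [reindex_apply, submatrix_apply, singularValueMatrix, of_apply, blockSigma_apply]
  rcases a with a | a <;> rcases b with b | b
  · have ha := (finSigmaFinEquiv a).2
    rw [fromBlocks_apply₁₁]
    by_cases hab : a = b
    · subst hab
      rw [dif_pos ⟨rfl, ha⟩, diagonal_apply_eq]
      exact congrArg (fun c ↦ σ c.1) (finSigmaFinEquiv.symm_apply_apply a)
    · rw [dif_neg, diagonal_apply_ne _ hab]
      exact fun h ↦ hab (finSigmaFinEquiv.injective (Fin.ext h.1))
  · have ha := (finSigmaFinEquiv a).2
    refine dif_neg ?_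
    rw [blockIndexEquiv_symm_inl, blockIndexEquiv_symm_inr]
    omega
  · refine dif_neg ?_
    rw [blockIndexEquiv_symm_inr]
    omega
  · refine dif_neg ?_
    rw [blockIndexEquiv_symm_inr]
    omega

theorem reindex_mem_orthogonalGroup {ι ι' : Type*} [Fintype ι] [Fintype ι'] [DecidableEq ι]
    [DecidableEq ι'] (e : ι ≃ ι') {U : Matrix ι ι ℝ} (hU : U ∈ orthogonalGroup ι ℝ) :
    reindex e e U ∈ orthogonalGroup ι' ℝ := by
  rw [mem_orthogonalGroup_iff] at hU ⊢
  rw [reindex_apply, transpose_submatrix, submatrix_mul_equiv, hU, submatrix_one_equiv]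

theorem reindex_mul_mul_transpose {ι ι' κ κ' : Type*} [Fintype ι] [Fintype ι'] [Fintype κ]
    [Fintype κ'] (e : ι ≃ ι') (e' : κ ≃ κ') (U : Matrix ι ι ℝ) (S : Matrix ι κ ℝ)
    (V : Matrix κ κ ℝ) : reindex e e' (U * S * Vᵀ) =
      reindex e e U * reindex e e' S * (reindex e' e' V)ᵀ := by
  simp only [reindex_apply, transpose_submatrix, submatrix_mul_equiv]

theorem mem_matricesWithMult_iff {n m : ℕ} (hn : ∑ j, k j ≤ n) (hm : ∑ j, k j ≤ m)
    (A : Matrix (Fin n) (Fin m) ℝ) : A ∈ matricesWithMult n m k ↔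
      reindex (blockIndexEquiv k hn) (blockIndexEquiv k hm) A ∈ blockOrbit _ _ k := by
  set e := blockIndexEquiv k hn
  set e' := blockIndexEquiv k hm
  constructor
  · rintro ⟨σ, h1, h2, U, hU, V, hV, rfl⟩
    refine ⟨σ, h1, h2, _, reindex_mem_orthogonalGroup e hU, _, reindex_mem_orthogonalGroup e' hV, ?_⟩
    rw [← reindex_singularValueMatrix hn hm, reindex_mul_mul_transpose]
  · rintro ⟨σ, h1, h2, U, hU, V, hV, h⟩
    refine ⟨σ, h1, h2, _, reindex_mem_orthogonalGroup e.symm hU, _,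
      reindex_mem_orthogonalGroup e'.symm hV, ?_⟩
    rw [← reindex_singularValueMatrix hn hm] at h
    apply (reindex e e').injective
    rw [h, reindex_mul_mul_transpose]
    simp [e, e']

theorem rank_of_mem_matricesWithMult {n m : ℕ} (hn : ∑ j, k j ≤ n) (hm : ∑ j, k j ≤ m)
    {A : Matrix (Fin n) (Fin m) ℝ} (hA : A ∈ matricesWithMult n m k) : A.rank = ∑ j, k j := by
  rw [← rank_of_mem_blockOrbit ((mem_matricesWithMult_iff hn hm A).mp hA), rank_reindex]

end Matrix

/-! ### Dimensions and the final count -/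

theorem IsSmoothSubmanifold.comap {E F : Type*} [NormedAddCommGroup E] [NormedSpace ℝ E]
    [NormedAddCommGroup F] [NormedSpace ℝ F] {S : Set E} {T : Set F} {d : ℕ} (e : E ≃L[ℝ] F)
    (h : IsSmoothSubmanifold T d) (hST : ∀ y, y ∈ S ↔ e y ∈ T) : IsSmoothSubmanifold S d :=
  fun x hx ↦ HasSmoothSliceAt.comap e (h _ ((hST x).mp hx)) hST

open Matrix in
theorem hasRealDim_matricesWithMult {n m J d : ℕ} {k : Fin J → ℕ} (hk : ∀ j, 1 ≤ k j)
    (hn : ∑ j, k j ≤ n) (hm : ∑ j, k j ≤ m)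
    (hd : d + (∑ j, (k j + 1).choose 2 + (n - ∑ j, k j) * (m - ∑ j, k j)) = n * m + J) :
    HasRealDim (matricesWithMult n m k) d := by
  -- The values `J, J - 1, …, 1` are positive and strictly decreasing.
  refine ⟨⟨singularValueMatrix n m k fun j ↦ (J : ℝ) - j, fun j ↦ (J : ℝ) - j, ?_, ?_, 1,
    one_mem _, 1, one_mem _, by simp⟩, ?_⟩
  · intro i j hij
    have : (i : ℝ) < j := by exact_mod_cast hij
    simpa using this
  · intro j
    simp
  · refine IsSmoothSubmanifold.comap
      (reindexLinearEquiv ℝ ℝ (blockIndexEquiv k hn) (blockIndexEquiv k hm)).toContinuousLinearEquiv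
      (isSmoothSubmanifold_blockOrbit hk ?_) (mem_matricesWithMult_iff hn hm)
    simp only [Fintype.card_fin, Nat.add_sub_cancel' hn, Nat.add_sub_cancel' hm]
    exact hd

open Matrix in
theorem hasRealDim_rank {n m r d : ℕ} (hn : r ≤ n) (hm : r ≤ m)
    (hd : d + (n - r) * (m - r) = n * m) :
    HasRealDim {A : Matrix (Fin n) (Fin m) ℝ | A.rank = r} d := by
  -- A single block of size `r` serves as base point; it may be empty, since the rank slice does not
  -- require nonempty blocks.
  obtain ⟨k, rfl⟩ : ∃ k : Fin 1 → ℕ, ∑ j, k j = r := ⟨fun _ ↦ r, by simp⟩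
  have hpos : ∀ j : Fin 1, (0 : ℝ) < (fun _ ↦ 1 : Fin 1 → ℝ) j := fun _ ↦ one_pos
  have hanti : StrictAnti (fun _ ↦ 1 : Fin 1 → ℝ) := Subsingleton.strictAnti _
  refine ⟨⟨singularValueMatrix n m k fun _ ↦ 1, ?_⟩, ?_⟩
  · exact rank_of_mem_matricesWithMult hn hm
      ⟨_, hanti, hpos, 1, one_mem _, 1, one_mem _, by simp⟩
  · refine IsSmoothSubmanifold.comap
      (reindexLinearEquiv ℝ ℝ (blockIndexEquiv k hn) (blockIndexEquiv k hm)).toContinuousLinearEquiv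
      (isSmoothSubmanifold_rank (k := k) hanti hpos ?_) fun A ↦ ?_
    · simpa only [Fintype.card_fin, Nat.add_sub_cancel' hn, Nat.add_sub_cancel' hm] using hd
    · change A.rank = _ ↔ (reindex _ _ A).rank = _
      rw [rank_reindex]

theorem corollary9p1 (n m J r : ℕ) (k : Fin J → ℕ) (hk : ∀ j, 1 ≤ k j)
    (hsum : ∑ j, k j = r) (hr : r ≤ min n m) :
    (∃ d : ℕ, HasRealDim (matricesWithMult n m k) d ∧
      (d : ℝ) = ((n : ℝ) + m - r) * r - r - (1 / 2) * ∑ j, (k j : ℝ) * ((k j : ℝ) - 1) + J) ∧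
    (∃ c : ℕ, HasRealCodimIn (matricesWithMult n m k)
        {A : Matrix (Fin n) (Fin m) ℝ | A.rank = r} c ∧
      (c : ℝ) = (1 / 2) * ∑ j, (k j : ℝ) * ((k j : ℝ) - 1) + r - J) := by
  subst hsum
  obtain ⟨hn, hm⟩ := le_min_iff.mp hr
  set r := ∑ j, k j with hrdef
  set s := ∑ j, (k j + 1).choose 2 with hs
  have hJs : J ≤ s := by
    calc J = ∑ _j : Fin J, 1 := by simp
      _ ≤ s := Finset.sum_le_sum fun j _ ↦ Nat.choose_pos (by have := hk j; omega)
  obtain ⟨p, rfl⟩ := Nat.exists_eq_add_of_le hn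
  obtain ⟨q, rfl⟩ := Nat.exists_eq_add_of_le hm
  -- Together with `hJs`, this lets the dimension and codimension be written as natural numbers `t +
  -- r * p + r * q + J` and `c`, where `r * r = s + t` and `s = J + c`, without truncated
  -- subtraction.
  have hsr : s ≤ r * r := by
    rw [hrdef, Finset.sum_mul]
    refine Finset.sum_le_sum fun j _ ↦ ?_
    have h1 : k j ≤ ∑ j, k j := Finset.single_le_sum (fun _ _ ↦ Nat.zero_le _) (Finset.mem_univ j)
    refine le_trans ?_ (Nat.mul_le_mul_left (k j) h1)
    rw [Nat.choose_two_right]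
    exact Nat.div_le_of_le_mul (by have := hk j; rw [Nat.add_sub_cancel]; nlinarith)
  have hsR : (s : ℝ) = (1 / 2) * ∑ j, (k j : ℝ) * ((k j : ℝ) - 1) + r := by
    rw [hs, hrdef, Finset.mul_sum]
    push_cast
    rw [← Finset.sum_add_distrib]
    refine Finset.sum_congr rfl fun j _ ↦ ?_
    rw [Nat.cast_choose_two]
    push_cast
    ring
  obtain ⟨t, ht⟩ := Nat.exists_eq_add_of_le hsr
  obtain ⟨c, hc⟩ := Nat.exists_eq_add_of_le hJs
  have hd1 : HasRealDim (matricesWithMult (r + p) (r + q) k) (t + r * p + r * q + J) := by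
    refine hasRealDim_matricesWithMult hk hn hm ?_
    rw [Nat.add_sub_cancel_left, Nat.add_sub_cancel_left, ← hs]
    have : (r + p) * (r + q) = r * r + r * p + r * q + p * q := by ring
    omega
  have hd2 : HasRealDim {A : Matrix (Fin (r + p)) (Fin (r + q)) ℝ | A.rank = r}
      (r * r + r * p + r * q) := by
    refine hasRealDim_rank hn hm ?_
    rw [Nat.add_sub_cancel_left, Nat.add_sub_cancel_left]
    ring
  have htR : (r : ℝ) * r = s + t := by exact_mod_cast ht
  have hcR : (s : ℝ) = J + c := by exact_mod_cast hc
  refine ⟨⟨_, hd1, ?_⟩, c, ⟨fun A hA ↦ Matrix.rank_of_mem_matricesWithMult hn hm hA, _, _, hd1, hd2,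
    by omega⟩, ?_⟩
  · push_cast
    linarith
  · linarith
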